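/- For $c>0$ and $x\in\mathbb{R}\setminus\mathbb{Q}$ consider the inequality $$\left|x-\frac pq\right|<\frac1{cq^2}\qquad(\ast)_c$$ where a rational solution is a rational number $p/q$ with $p\in\mathbb{Z}$, $q\geq 1$, $\gcd(p,q)=1$ (so each rational number is counted once). The Lagrange value of $x$ is $$k(x)=\sup\{c>0 : (\ast)_c \text{ has infinitely many rational solutions}\}\in(0,\infty].$$ For $n\in\mathbb{N}\cup\{\infty\}$, where $\mathbb{N}=\{0,1,2,\dots\}$, let $X_3(n)$ be the set of all $x\in\mathbb{R}\setminus\mathbb{Q}$ such that $k(x)=3$ and $\left|x-\frac pq\right|<\frac1{3q^2}$ has exactly $n$ rational solutions (infinitely many if $n=\infty$). Then for every $n\in\mathbb{N}\cup\{\infty\}$ the set $X_3(n)$ is uncountable. Consequently, the set $X_3$ of all $x\in\mathbb{R}\setminus\mathbb{Q}$ for which $\left|x-\frac pq\right|<\frac1{3q^2}$ has only finitely many rational solutions is uncountable. -/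

import Mathlib

/-- The rational solutions `p/q` of `|x - p/q| < 1/(c q²)`. Each rational number is counted once,
with `q` its reduced denominator. (A rational number satisfies the inequality for some
representation `p/q` if and only if it does so for the reduced one.) -/
def ratSolutions (c x : ℝ) : Set ℚ :=
  {r : ℚ | |x - (r : ℝ)| < 1 / (c * (r.den : ℝ) ^ 2)}

/-- The Lagrange value `k(x)`: the supremum, in the extended reals, of all `c > 0` for which
`|x - p/q| < 1/(c q²)` has infinitely many rational solutions. -/
noncomputable def lagrangeValue (x : ℝ) : EReal :=
  sSup ((fun c : ℝ => (c : EReal)) '' {c : ℝ | 0 < c ∧ (ratSolutions c x).Infinite})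

/-- The set `X_c` of irrationals `x` for which `|x - p/q| < 1/(c q²)` has only finitely many
rational solutions. -/
def finSolSet (c : ℝ) : Set ℝ :=
  {x : ℝ | Irrational x ∧ (ratSolutions c x).Finite}

/-- The set `X_3(n)`, `n ∈ ℕ ∪ {∞}`, of irrationals `x` with Lagrange value `3` for which
`|x - p/q| < 1/(3 q²)` has exactly `n` rational solutions. -/
def exactSolSet (n : ℕ∞) : Set ℝ :=
  {x : ℝ | Irrational x ∧ lagrangeValue x = 3 ∧ (ratSolutions 3 x).encard = n}

/-! By Legendre's theorem, for c ≥ 2 the solutions are the convergents whose constant λ_k =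
[a_{k+1}; a_{k+2}, …] + [0; a_k, …, a_1] exceeds c, so only the sequence λ_k matters.

Take a Sturmian word of irrational slope α in (0, 1), write 1, 1 for each 0 and 2, 2 for each 1, and
put a constant block d, …, d in front. The identity 1/(2 + s) = 1 - [0; 1, 1 + s] turns λ_k at a
letter 1 into 3 plus a difference of two continued fractions, one read backwards and one forwards
(`approxConst_fst_of_one`, `approxConst_snd_of_one`). Around a factor 01 or 10 its sign is decided
where the two readings first differ. Balance of the word forces λ_k < 3, unless the word is
symmetric about a 01 all the way to its start; then the block in front breaks the tie. Each
symmetric letter shrinks the difference by a factor 4, and good approximations to α give arbitrarily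
long symmetries, so limsup λ_k = 3.

A block of 3s makes exactly the first n constants exceed 3 and breaks every later tie downwards. A
block 1, 1, 1 breaks infinitely many ties upwards. Since α can be recovered from the number, each
set is uncountable. -/

/-! ### Infinite continued fractions through their complete quotients. -/

/-- `R k = [A k; A (k+1), A (k+2), …]` for a sequence `A` of positive partial quotients. -/
def IsCompleteQuotients (A : ℕ → ℕ) (R : ℕ → ℝ) : Prop :=
  ∀ k, 1 ≤ A k ∧ 1 < R k ∧ R k = A k + 1 / R (k + 1)

/-- Compactness: the first N equations, cleared of denominators, cut out nested closed nonempty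
subsets of a product of compact intervals. A common point satisfies all equations, which then force
1 < R k. -/
theorem exists_isCompleteQuotients (A : ℕ → ℕ) (hA : ∀ k, 1 ≤ A k) :
    ∃ R, IsCompleteQuotients A R := by
  let K : Set (ℕ → ℝ) := Set.pi Set.univ fun k => Set.Icc (1 : ℝ) (A k + 1)
  have hK : IsCompact K := isCompact_univ_pi fun k => isCompact_Icc
  let C : ℕ → Set (ℕ → ℝ) := fun N => K ∩ {R | ∀ k < N, R k * R (k + 1) = A k * R (k + 1) + 1}
  have hC : ∀ N, IsClosed (C N) := by
    intro N
    refine hK.isClosed.inter ?_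
    simp only [Set.ofPred_forall]
    exact isClosed_iInter fun k => isClosed_iInter fun _ =>
      isClosed_eq (by fun_prop) (by fun_prop)
  have hne : ∀ N, (C N).Nonempty := by
    have key : ∀ N (B : ℕ → ℕ), (∀ k, 1 ≤ B k) → ∃ R : ℕ → ℝ,
        (∀ k, R k ∈ Set.Icc (1 : ℝ) (B k + 1)) ∧
          ∀ k < N, R k * R (k + 1) = B k * R (k + 1) + 1 := by
      intro N
      induction N with
      | zero => exact fun B hB => ⟨fun k => 1, fun k => ⟨le_rfl, by simp⟩, by simp⟩
      | succ N ih =>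
        intro B hB
        obtain ⟨R, h1, h2⟩ := ih (fun k => B (k + 1)) fun k => hB _
        refine ⟨fun k => Nat.casesOn k ((B 0 : ℝ) + 1 / R 0) R, ?_, ?_⟩
        · rintro (_ | k)
          · have h0 := (h1 0).1
            have hB0 : (1 : ℝ) ≤ B 0 := by exact_mod_cast hB 0
            have : 1 / R 0 ≤ 1 := by rw [div_le_one (by linarith)]; exact h0
            have : 0 < 1 / R 0 := by positivity
            change (1 : ℝ) ≤ B 0 + 1 / R 0 ∧ B 0 + 1 / R 0 ≤ (B 0 + 1 : ℝ)
            constructor <;> linarith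
          · exact h1 k
        · rintro (_ | k) hk
          · have h0 := (h1 0).1
            have : R 0 ≠ 0 := by linarith
            change (B 0 + 1 / R 0) * R 0 = B 0 * R 0 + 1
            field_simp
          · exact h2 k (by omega)
    intro N
    obtain ⟨R, h1, h2⟩ := key N A hA
    exact ⟨R, fun k _ => h1 k, h2⟩
  obtain ⟨R, hR⟩ := IsCompact.nonempty_iInter_of_sequence_nonempty_isCompact_isClosed C
    (fun N R hR => ⟨hR.1, fun k hk => hR.2 k (by omega)⟩) hne
    (hK.inter_right (by simp)) hC
  rw [Set.mem_iInter] at hR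
  refine ⟨R, fun k => ?_⟩
  have h1 : 1 ≤ R (k + 1) := ((hR 0).1 (k + 1) trivial).1
  have h2 := (hR (k + 1)).2 k (by omega)
  have hA' : (1 : ℝ) ≤ A k := by exact_mod_cast hA k
  have h3 : R k = A k + 1 / R (k + 1) := by
    field_simp
    exact h2
  have : 0 < 1 / R (k + 1) := by positivity
  exact ⟨hA k, by linarith, h3⟩

namespace IsCompleteQuotients

variable {A : ℕ → ℕ} {R : ℕ → ℝ}

theorem shift (h : IsCompleteQuotients A R) (n : ℕ) :
    IsCompleteQuotients (fun k => A (k + n)) fun k => R (k + n) := fun k => by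
  have := h (k + n)
  rwa [show k + n + 1 = k + 1 + n by omega] at this

theorem pos (h : IsCompleteQuotients A R) (k : ℕ) : 0 < R k := one_pos.trans (h k).2.1

theorem one_le (h : IsCompleteQuotients A R) (k : ℕ) : (1 : ℝ) ≤ A k := by
  exact_mod_cast (h k).1

theorem floor_eq (h : IsCompleteQuotients A R) (k : ℕ) : ⌊R k⌋ = (A k : ℤ) := by
  rw [Int.floor_eq_iff]
  have h1 := h.pos (k + 1)
  have h2 : 1 / R (k + 1) < 1 := (div_lt_one h1).2 (h (k + 1)).2.1
  have h3 : 0 < 1 / R (k + 1) := by positivity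
  have h4 := (h k).2.2
  push_cast
  constructor <;> linarith

theorem inv_fract_eq (h : IsCompleteQuotients A R) (k : ℕ) : (Int.fract (R k))⁻¹ = R (k + 1) := by
  rw [← Int.self_sub_floor, h.floor_eq, (h k).2.2]
  simp

theorem eq_of_zero_eq {B : ℕ → ℕ} {S : ℕ → ℝ} (h : IsCompleteQuotients A R)
    (h' : IsCompleteQuotients B S) (h0 : R 0 = S 0) : A = B := by
  have key : ∀ k, R k = S k := by
    intro k
    induction k with
    | zero => exact h0
    | succ k ih => rw [← h.inv_fract_eq, ← h'.inv_fract_eq, ih]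
  funext k
  have := h.floor_eq k
  rw [key, h'.floor_eq] at this
  exact_mod_cast this.symm

/-- Infinite descent: if R k has denominator q, then R (k + 1) has a smaller one, namely the
remainder p - A k * q. -/
theorem irrational (h : IsCompleteQuotients A R) : Irrational (R 0) := by
  have key : ∀ (q : ℕ) (k : ℕ) (p : ℤ), 0 < q → R k * q ≠ p := by
    intro q
    induction q using Nat.strong_induction_on with
    | _ q ih =>
      intro k p hq hp
      have h1 := h.pos (k + 1)
      have hq' : (0 : ℝ) < q := by exact_mod_cast hq
      have h4 := (h k).2.2
      have e : ((p - A k * q : ℤ) : ℝ) = q / R (k + 1) := by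
        push_cast
        rw [← hp, h4]
        ring
      have hpos : 0 < p - A k * q := by
        have : (0 : ℝ) < ((p - A k * q : ℤ) : ℝ) := by rw [e]; positivity
        exact_mod_cast this
      obtain ⟨r, hr⟩ := Int.eq_ofNat_of_zero_le hpos.le
      rw [hr] at e hpos
      push_cast at e
      have hlt : r < q := by
        have : (r : ℝ) < q := by
          rw [e]
          exact div_lt_self hq' (h (k + 1)).2.1
        exact_mod_cast this
      refine ih r hlt (k + 1) q (by omega) ?_
      rw [e]
      push_cast
      field_simp
  rintro ⟨r, hr⟩
  refine key r.den 0 r.num r.pos ?_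
  rw [← hr]
  exact_mod_cast Rat.mul_den_eq_num r

end IsCompleteQuotients

/-! ### Convergents, approximation constants and the Lagrange value. -/

/-- Numerators of the convergents of `[A 0; A 1, …]`, shifted so that the recurrence starts from
the two formal convergents `0/1` and `1/0`. -/
def convNum (A : ℕ → ℕ) : ℕ → ℤ
  | 0 => 0
  | 1 => 1
  | k + 2 => A k * convNum A (k + 1) + convNum A k

/-- Denominators of the convergents of `[A 0; A 1, …]`, with the same shift as `convNum`. -/
def convDen (A : ℕ → ℕ) : ℕ → ℤ
  | 0 => 1
  | 1 => 0
  | k + 2 => A k * convDen A (k + 1) + convDen A k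

/-- The finite continued fraction `[0; A k, …, A 1]`. -/
noncomputable def backQuot (A : ℕ → ℕ) : ℕ → ℝ
  | 0 => 0
  | k + 1 => 1 / (A (k + 1) + backQuot A k)

/-- The quantity `λ` with `|x - p/q| = 1 / (λ q²)` for the `k`-th convergent `p/q`. -/
noncomputable def approxConst (A : ℕ → ℕ) (R : ℕ → ℝ) (k : ℕ) : ℝ :=
  R (k + 1) + backQuot A k

/-- Peels off the first partial quotient instead of the last, to match the recursion of
`Real.convergent`. Two consecutive indices are carried for the induction. -/
theorem convNum_succ_convDen_succ (A : ℕ → ℕ) (k : ℕ) :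
    (convNum A (k + 1) = A 0 * convNum (fun i => A (i + 1)) k + convDen (fun i => A (i + 1)) k ∧
      convDen A (k + 1) = convNum (fun i => A (i + 1)) k) ∧
    (convNum A (k + 2) =
        A 0 * convNum (fun i => A (i + 1)) (k + 1) + convDen (fun i => A (i + 1)) (k + 1) ∧
      convDen A (k + 2) = convNum (fun i => A (i + 1)) (k + 1)) := by
  induction k with
  | zero => simp [convNum, convDen]
  | succ k ih =>
    refine ⟨ih.2, ?_, ?_⟩
    · rw [convNum, ih.2.1, ih.1.1, convNum, convDen]
      ring
    · rw [convNum, convDen, ih.2.2, ih.1.2]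

theorem convNum_mul_convDen_sub (A : ℕ → ℕ) (k : ℕ) :
    convNum A (k + 1) * convDen A k - convNum A k * convDen A (k + 1) = (-1) ^ k := by
  induction k with
  | zero => simp [convNum, convDen]
  | succ k ih =>
    rw [convNum, convDen, pow_succ, ← ih]
    ring

namespace IsCompleteQuotients

variable {A : ℕ → ℕ} {R : ℕ → ℝ}

theorem convDen_pos (h : IsCompleteQuotients A R) (k : ℕ) :
    0 ≤ convDen A (k + 1) ∧ 0 < convDen A (k + 2) := by
  induction k with
  | zero => simp [convDen]
  | succ k ih =>
    refine ⟨ih.2.le, ?_⟩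
    rw [convDen]
    have := (h (k + 1)).1
    have h2 := ih.2
    have : (1 : ℤ) ≤ A (k + 1) := by exact_mod_cast this
    nlinarith [ih.1]

theorem convDen_pos_real (h : IsCompleteQuotients A R) (k : ℕ) :
    (0 : ℝ) < convDen A (k + 2) := by exact_mod_cast (h.convDen_pos k).2

theorem convNum_pos (h : IsCompleteQuotients A R) (k : ℕ) : 0 < convNum A (k + 1) := by
  induction k using Nat.strong_induction_on with
  | _ k ih =>
    match k with
    | 0 => simp [convNum]
    | 1 =>
      simp only [convNum]
      have := (h 0).1
      omega
    | k + 2 =>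
      rw [convNum]
      have h1 := ih (k + 1) (by omega)
      have h2 := ih k (by omega)
      positivity

theorem convergent_eq (h : IsCompleteQuotients A R) (k : ℕ) :
    (R 0).convergent k = (convNum A (k + 2) : ℚ) / convDen A (k + 2) := by
  induction k generalizing A R with
  | zero =>
    rw [Real.convergent_zero, h.floor_eq]
    simp [convNum, convDen]
  | succ k ih =>
    rw [Real.convergent_succ, h.floor_eq, h.inv_fract_eq, ih (h.shift 1)]
    obtain ⟨h1, h2⟩ := (convNum_succ_convDen_succ A (k + 1)).2
    rw [h1, h2]
    have := (h.shift 1).convNum_pos (k + 1)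
    have : (convNum (fun i => A (i + 1)) (k + 2) : ℚ) ≠ 0 := by exact_mod_cast this.ne'
    push_cast
    field_simp

theorem mul_eq (h : IsCompleteQuotients A R) (k : ℕ) :
    R 0 * (R k * convDen A (k + 1) + convDen A k) = R k * convNum A (k + 1) + convNum A k := by
  induction k with
  | zero => simp [convDen, convNum]
  | succ k ih =>
    have h1 := h.pos (k + 1)
    rw [(h k).2.2] at ih
    rw [convDen, convNum]
    push_cast
    field_simp at ih
    linarith

theorem backQuot_eq (h : IsCompleteQuotients A R) (k : ℕ) :
    backQuot A k = (convDen A (k + 1) : ℝ) / convDen A (k + 2) := by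
  induction k with
  | zero => simp [backQuot, convDen]
  | succ k ih =>
    have h1 := h.convDen_pos_real k
    have h2 := h.convDen_pos_real (k + 1)
    have e : (convDen A (k + 3) : ℝ) = A (k + 1) * convDen A (k + 2) + convDen A (k + 1) := by
      rw [convDen]; push_cast; rfl
    rw [e] at h2
    rw [backQuot, ih, e]
    field_simp

theorem backQuot_nonneg (h : IsCompleteQuotients A R) (k : ℕ) : 0 ≤ backQuot A k := by
  rw [h.backQuot_eq]
  have := h.convDen_pos_real k
  have : (0 : ℝ) ≤ convDen A (k + 1) := by exact_mod_cast (h.convDen_pos k).1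
  positivity

theorem approxConst_pos (h : IsCompleteQuotients A R) (k : ℕ) : 0 < approxConst A R k :=
  add_pos_of_pos_of_nonneg (h.pos _) (h.backQuot_nonneg k)

theorem abs_sub_convergent (h : IsCompleteQuotients A R) (k : ℕ) :
    |R 0 - ((R 0).convergent k : ℝ)| =
      1 / (approxConst A R k * (convDen A (k + 2) : ℝ) ^ 2) := by
  have hq := h.convDen_pos_real k
  have hq1 : (0 : ℝ) ≤ convDen A (k + 1) := by exact_mod_cast (h.convDen_pos k).1
  have hR := h.pos (k + 1)
  have hd : (0 : ℝ) < R (k + 1) * convDen A (k + 2) + convDen A (k + 1) := by positivity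
  have hm := h.mul_eq (k + 1)
  have hdet : ((convNum A (k + 2) : ℝ) * convDen A (k + 1) -
      convNum A (k + 1) * convDen A (k + 2)) = (-1) ^ (k + 1) := by
    exact_mod_cast convNum_mul_convDen_sub A (k + 1)
  have e : R 0 - ((R 0).convergent k : ℝ) = (-1) ^ k /
      ((R (k + 1) * convDen A (k + 2) + convDen A (k + 1)) * convDen A (k + 2)) := by
    rw [h.convergent_eq]
    push_cast
    rw [eq_div_iff (by positivity), sub_mul, ← mul_assoc, hm, pow_succ] at *
    field_simp
    linarith
  rw [e, abs_div, abs_pow, abs_neg, abs_one, one_pow, abs_of_pos (by positivity),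
    approxConst, h.backQuot_eq]
  congr 1
  field_simp

theorem den_convergent (h : IsCompleteQuotients A R) (k : ℕ) :
    (((R 0).convergent k).den : ℤ) = convDen A (k + 2) := by
  rw [h.convergent_eq]
  refine Rat.den_div_eq_of_coprime (h.convDen_pos k).2 ?_
  rw [← Int.isCoprime_iff_nat_coprime]
  have hdet := convNum_mul_convDen_sub A (k + 1)
  rcases neg_one_pow_eq_or ℤ (k + 1) with h1 | h1 <;> rw [h1] at hdet
  · exact ⟨convDen A (k + 1), -convNum A (k + 1), by linarith⟩
  · exact ⟨-convDen A (k + 1), convNum A (k + 1), by linarith⟩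

/-- The errors |x - p/q| strictly decrease, because λ_k q_k² strictly increases. -/
theorem convergent_injective (h : IsCompleteQuotients A R) :
    Function.Injective (R 0).convergent := by
  have hmono : StrictMono fun k => approxConst A R k * (convDen A (k + 2) : ℝ) ^ 2 := by
    refine strictMono_nat_of_lt_succ fun k => ?_
    have hq := h.convDen_pos_real k
    have hq' := h.convDen_pos_real (k + 1)
    have hq1 : (0 : ℝ) ≤ convDen A (k + 1) := by exact_mod_cast (h.convDen_pos k).1
    have hrec : (convDen A (k + 3) : ℝ) = A (k + 1) * convDen A (k + 2) + convDen A (k + 1) := by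
      rw [convDen]; push_cast; rfl
    have hA := h.one_le (k + 1)
    have hR := (h (k + 2)).2.1
    have hR1 : R (k + 1) = A (k + 1) + 1 / R (k + 2) := (h (k + 1)).2.2
    have hlt : 1 / R (k + 2) < 1 := (div_lt_one (by linarith)).2 hR
    have e1 : approxConst A R k * (convDen A (k + 2) : ℝ) ^ 2 =
        convDen A (k + 2) * (convDen A (k + 3) + convDen A (k + 2) * (1 / R (k + 2))) := by
      rw [approxConst, h.backQuot_eq, hR1, hrec]
      field_simp
      ring
    have e2 : approxConst A R (k + 1) * (convDen A (k + 3) : ℝ) ^ 2 =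
        convDen A (k + 3) * (R (k + 2) * convDen A (k + 3) + convDen A (k + 2)) := by
      rw [approxConst, h.backQuot_eq]
      field_simp
    have hle : (convDen A (k + 2) : ℝ) ≤ convDen A (k + 3) := by rw [hrec]; nlinarith
    simp only [e1, e2]
    refine mul_lt_mul' hle ?_ (by positivity) hq'
    nlinarith
  intro k l hkl
  have h1 := h.abs_sub_convergent k
  rw [hkl, h.abs_sub_convergent l, one_div, one_div, inv_inj] at h1
  exact hmono.injective h1.symm

/-- Legendre's theorem in quantitative form. -/
theorem ratSolutions_eq (h : IsCompleteQuotients A R) {c : ℝ} (hc : 2 ≤ c) :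
    ratSolutions c (R 0) = (R 0).convergent '' {k | c < approxConst A R k} := by
  have hiff : ∀ k, (R 0).convergent k ∈ ratSolutions c (R 0) ↔ c < approxConst A R k := by
    intro k
    have hq := h.convDen_pos_real k
    have hd : (((R 0).convergent k).den : ℝ) = convDen A (k + 2) := by
      exact_mod_cast h.den_convergent k
    have := h.approxConst_pos k
    rw [ratSolutions, Set.mem_ofPred_eq, h.abs_sub_convergent, hd,
      one_div_lt_one_div (by positivity) (by positivity), mul_lt_mul_iff_left₀ (by positivity)]
  ext r
  constructor
  · intro hr
    have hden : (0 : ℝ) < r.den := by exact_mod_cast r.pos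
    have : |R 0 - r| < 1 / (2 * (r.den : ℝ) ^ 2) := by
      refine lt_of_lt_of_le hr ?_
      gcongr
    obtain ⟨k, rfl⟩ := Real.exists_rat_eq_convergent this
    exact ⟨k, (hiff k).1 hr, rfl⟩
  · rintro ⟨k, hk, rfl⟩
    exact (hiff k).2 hk

theorem lagrangeValue_eq_three (h : IsCompleteQuotients A R)
    (hlow : ∀ c < 3, {k | c < approxConst A R k}.Infinite)
    (hup : ∀ c > 3, {k | c < approxConst A R k}.Finite) : lagrangeValue (R 0) = 3 := by
  have e3 : (3 : EReal) = ((3 : ℝ) : EReal) := rfl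
  refine le_antisymm ?_ ?_
  · refine sSup_le ?_
    rintro _ ⟨c, ⟨_, hc⟩, rfl⟩
    rw [e3, EReal.coe_le_coe_iff]
    by_contra! hlt
    rw [h.ratSolutions_eq (by linarith)] at hc
    exact hc ((hup c hlt).image _)
  · refine le_of_forall_lt fun b hb => ?_
    obtain ⟨c, hbc, hc3⟩ := EReal.lt_iff_exists_real_btwn.1 hb
    rw [e3, EReal.coe_lt_coe_iff] at hc3
    -- Passing to `max c 2` keeps the constant below 3 and inside the range of Legendre's theorem.
    refine lt_of_lt_of_le hbc (le_trans (EReal.coe_le_coe_iff.2 (le_max_left c 2)) (le_sSup ?_))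
    refine ⟨max c 2, ⟨by positivity, ?_⟩, rfl⟩
    rw [h.ratSolutions_eq (le_max_right _ _)]
    exact (hlow _ (max_lt hc3 (by norm_num))).image h.convergent_injective.injOn

end IsCompleteQuotients

/-! ### Mechanical words: balance and symmetry. -/

/-- The lower mechanical word of slope `α` and intercept `0`. -/
noncomputable def mechWord (α : ℝ) (i : ℕ) : ℕ :=
  (⌊((i + 1 : ℕ) : ℝ) * α⌋ - ⌊(i : ℝ) * α⌋).toNat

/-- The `J` letters before the pair `w i, w (i + 1)`, read backwards, agree with the `J` letters
after it. -/
def MirrorAt (w : ℕ → ℕ) (i J : ℕ) : Prop :=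
  ∀ j < J, w (i - 1 - j) = w (i + 2 + j)

section MechWord

variable {α : ℝ}

theorem mechWord_eq (h0 : 0 < α) (i : ℕ) :
    (mechWord α i : ℤ) = ⌊((i + 1 : ℕ) : ℝ) * α⌋ - ⌊(i : ℝ) * α⌋ := by
  rw [mechWord, Int.toNat_of_nonneg]
  rw [sub_nonneg]
  refine Int.floor_le_floor ?_
  push_cast
  nlinarith

theorem mechWord_le_one (h0 : 0 < α) (h1 : α < 1) (i : ℕ) : mechWord α i ≤ 1 := by
  have h := mechWord_eq h0 i
  have a := Int.floor_le (((i + 1 : ℕ) : ℝ) * α)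
  have b := Int.lt_floor_add_one ((i : ℝ) * α)
  have : (mechWord α i : ℤ) < 2 := by
    rw [h]
    have : ((⌊((i + 1 : ℕ) : ℝ) * α⌋ - ⌊(i : ℝ) * α⌋ : ℤ) : ℝ) < 2 := by
      push_cast at a ⊢
      linarith
    exact_mod_cast this
  omega

theorem mechWord_zero (h0 : 0 < α) (h1 : α < 1) : mechWord α 0 = 0 := by
  have h := mechWord_eq h0 0
  have : ⌊α⌋ = 0 := Int.floor_eq_zero_iff.2 ⟨h0.le, h1⟩
  simpa [this] using h

/-- The slope of a mechanical word is determined by the word. -/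
theorem mechWord_injOn : Set.InjOn mechWord (Set.Ioi 0) := by
  intro α hα β hβ h
  have key : ∀ m : ℕ, ⌊(m : ℝ) * α⌋ = ⌊(m : ℝ) * β⌋ := by
    intro m
    induction m with
    | zero => simp
    | succ m ih =>
      have a := mechWord_eq hα m
      have b := mechWord_eq hβ m
      rw [h] at a
      omega
  by_contra hne
  obtain ⟨m, hm⟩ := exists_nat_gt (1 / |α - β|)
  have hpos : 0 < |α - β| := abs_pos.2 (sub_ne_zero.2 hne)
  have h1 := Int.abs_sub_lt_one_of_floor_eq_floor (key m)
  rw [← mul_sub, abs_mul, Nat.abs_cast] at h1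
  rw [div_lt_iff₀ hpos] at hm
  linarith

theorem MirrorAt.floor_sub {i J : ℕ} (h0 : 0 < α) (hJ : J ≤ i) (h : MirrorAt (mechWord α) i J) :
    ⌊(i : ℝ) * α⌋ - ⌊((i - J : ℕ) : ℝ) * α⌋ =
      ⌊((i + 2 + J : ℕ) : ℝ) * α⌋ - ⌊((i + 2 : ℕ) : ℝ) * α⌋ := by
  induction J with
  | zero => simp
  | succ J ih =>
    have ih := ih (by omega) fun j hj => h j (by omega)
    have e := h J (by omega)
    have a := mechWord_eq h0 (i - 1 - J)
    have b := mechWord_eq h0 (i + 2 + J)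
    rw [show i - 1 - J + 1 = i - J by omega, show i - 1 - J = i - (J + 1) by omega] at a
    rw [show i - 1 - J = i - (J + 1) by omega] at e
    rw [e] at a
    rw [show i + 2 + J + 1 = i + 2 + (J + 1) by omega] at b
    omega

/-- Balance: two windows of equal length have letter sums differing by at most 1. -/
theorem floor_window_lt (α : ℝ) (i j L : ℕ) :
    ⌊((i + L : ℕ) : ℝ) * α⌋ - ⌊(i : ℝ) * α⌋ <
      ⌊((j + L : ℕ) : ℝ) * α⌋ - ⌊(j : ℝ) * α⌋ + 2 := by
  have h1 := Int.floor_le (((i + L : ℕ) : ℝ) * α)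
  have h2 := Int.lt_floor_add_one ((i : ℝ) * α)
  have h3 := Int.lt_floor_add_one (((j + L : ℕ) : ℝ) * α)
  have h4 := Int.floor_le ((j : ℝ) * α)
  have : ((⌊((i + L : ℕ) : ℝ) * α⌋ - ⌊(i : ℝ) * α⌋ : ℤ) : ℝ) <
      ((⌊((j + L : ℕ) : ℝ) * α⌋ - ⌊(j : ℝ) * α⌋ + 2 : ℤ) : ℝ) := by
    push_cast at *
    linarith
  exact_mod_cast this

theorem exists_first_mismatch (w : ℕ → ℕ) (i : ℕ) (h : ¬ MirrorAt w i i) :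
    ∃ J < i, MirrorAt w i J ∧ w (i - 1 - J) ≠ w (i + 2 + J) := by
  classical
  have h' : ∃ J, J < i ∧ w (i - 1 - J) ≠ w (i + 2 + J) := by
    simpa [MirrorAt] using h
  refine ⟨Nat.find h', (Nat.find_spec h').1, fun j hj => ?_, (Nat.find_spec h').2⟩
  have := (Nat.find_spec h').1
  by_contra hne
  exact Nat.find_min h' hj ⟨by omega, hne⟩

/-- Symmetry about 10 down to the start, with S the sum of the first i letters, would give 2(S + 1)
≤ 2S + 1 by superadditivity of the floor. At the first mismatch, the wrong order would create
factors 1u1 and 0u'0, with u' the reversal of u, against balance. -/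
theorem mechWord_mismatch_of_descent (h0 : 0 < α) (h1 : α < 1) {i : ℕ}
    (hi : mechWord α i = 1) (hi' : mechWord α (i + 1) = 0) :
    ∃ J < i, MirrorAt (mechWord α) i J ∧
      mechWord α (i - 1 - J) = 0 ∧ mechWord α (i + 2 + J) = 1 := by
  have e1 := mechWord_eq h0 i
  have e2 := mechWord_eq h0 (i + 1)
  rw [hi] at e1
  rw [hi'] at e2
  by_cases hm : MirrorAt (mechWord α) i i
  · exfalso
    have hs := hm.floor_sub h0 le_rfl
    have h2 : 2 * ⌊((i + 1 : ℕ) : ℝ) * α⌋ ≤ ⌊((i + 2 + i : ℕ) : ℝ) * α⌋ := by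
      rw [Int.le_floor]
      have := Int.floor_le (((i + 1 : ℕ) : ℝ) * α)
      push_cast at this ⊢
      linarith
    simp only [Nat.sub_self, Nat.cast_zero, zero_mul, Int.floor_zero] at hs
    rw [show i + 1 + 1 = i + 2 by omega] at e2
    omega
  · obtain ⟨J, hJ, hmJ, hne⟩ := exists_first_mismatch _ _ hm
    refine ⟨J, hJ, hmJ, ?_⟩
    by_contra hcon
    have l1 := mechWord_le_one h0 h1 (i - 1 - J)
    have l2 := mechWord_le_one h0 h1 (i + 2 + J)
    have d1 : mechWord α (i - 1 - J) = 1 := by omega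
    have d2 : mechWord α (i + 2 + J) = 0 := by omega
    have hs := hmJ.floor_sub h0 hJ.le
    have f1 := mechWord_eq h0 (i - 1 - J)
    have f2 := mechWord_eq h0 (i + 2 + J)
    rw [d1, show i - 1 - J + 1 = i - J by omega] at f1
    rw [d2] at f2
    have hb := floor_window_lt α (i - 1 - J) (i + 1) (J + 2)
    rw [show i - 1 - J + (J + 2) = i + 1 by omega,
      show i + 1 + (J + 2) = i + 2 + J + 1 by omega] at hb
    rw [show i + 1 + 1 = i + 2 by omega] at e2
    omega

/-- Balance works as for 10, but about 01 superadditivity no longer excludes full symmetry: these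
are the ties left to the initial block. -/
theorem mechWord_mismatch_of_ascent (h0 : 0 < α) (h1 : α < 1) {i : ℕ}
    (hi : mechWord α i = 0) (hi' : mechWord α (i + 1) = 1) :
    MirrorAt (mechWord α) i i ∨ ∃ J < i, MirrorAt (mechWord α) i J ∧
      mechWord α (i - 1 - J) = 1 ∧ mechWord α (i + 2 + J) = 0 := by
  have e1 := mechWord_eq h0 i
  have e2 := mechWord_eq h0 (i + 1)
  rw [hi] at e1
  rw [hi'] at e2
  by_cases hm : MirrorAt (mechWord α) i i
  · exact Or.inl hm
  · obtain ⟨J, hJ, hmJ, hne⟩ := exists_first_mismatch _ _ hm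
    refine Or.inr ⟨J, hJ, hmJ, ?_⟩
    by_contra hcon
    have l1 := mechWord_le_one h0 h1 (i - 1 - J)
    have l2 := mechWord_le_one h0 h1 (i + 2 + J)
    have d1 : mechWord α (i - 1 - J) = 0 := by omega
    have d2 : mechWord α (i + 2 + J) = 1 := by omega
    have hs := hmJ.floor_sub h0 hJ.le
    have f1 := mechWord_eq h0 (i - 1 - J)
    have f2 := mechWord_eq h0 (i + 2 + J)
    rw [d1, show i - 1 - J + 1 = i - J by omega] at f1
    rw [d2] at f2
    have hb := floor_window_lt α (i + 1) (i - 1 - J) (J + 2)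
    rw [show i - 1 - J + (J + 2) = i + 1 by omega,
      show i + 1 + (J + 2) = i + 2 + J + 1 by omega] at hb
    rw [show i + 1 + 1 = i + 2 by omega] at e2
    omega

/-- Around an almost integral multiple `(i + 1) α ≈ K` the mechanical word is symmetric. -/
theorem mirrorAt_of_near (h0 : 0 < α) (h1 : α < 1) {i J : ℕ} {K : ℤ} {e : ℝ} (hJ : J ≤ i)
    (he : ((i + 1 : ℕ) : ℝ) * α = K + e)
    (hnear : ∀ j : ℕ, 1 ≤ j → j ≤ J + 1 →
      ((⌊(j : ℝ) * α⌋ : ℝ) ≤ j * α + e ∧ j * α + e < ⌊(j : ℝ) * α⌋ + 1) ∧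
      ((⌊(j : ℝ) * α⌋ : ℝ) < j * α - e ∧ j * α - e ≤ ⌊(j : ℝ) * α⌋ + 1)) :
    MirrorAt (mechWord α) i J ∧ mechWord α i + mechWord α (i + 1) = 1 := by
  have hr : ∀ j : ℕ, 1 ≤ j → j ≤ J + 1 →
      ⌊((i + 1 + j : ℕ) : ℝ) * α⌋ = K + ⌊(j : ℝ) * α⌋ := by
    intro j hj hj'
    obtain ⟨⟨a, b⟩, -⟩ := hnear j hj hj'
    rw [Int.floor_eq_iff]
    push_cast at he ⊢
    constructor <;> linarith
  have hl : ∀ j : ℕ, 1 ≤ j → j ≤ J + 1 →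
      ⌊((i + 1 - j : ℕ) : ℝ) * α⌋ = K - ⌊(j : ℝ) * α⌋ - 1 := by
    intro j hj hj'
    obtain ⟨-, a, b⟩ := hnear j hj hj'
    rw [Int.floor_eq_iff, Nat.cast_sub (by omega)]
    push_cast at he ⊢
    constructor <;> linarith
  constructor
  · intro j hj
    have a := mechWord_eq h0 (i - 1 - j)
    have b := mechWord_eq h0 (i + 2 + j)
    rw [show i - 1 - j + 1 = i + 1 - (j + 1) by omega, hl _ (by omega) (by omega),
      show ((i - 1 - j : ℕ) : ℝ) = ((i + 1 - (j + 2) : ℕ) : ℝ) by congr 1; omega,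
      hl _ (by omega) (by omega)] at a
    rw [show i + 2 + j + 1 = i + 1 + (j + 2) by omega, hr _ (by omega) (by omega),
      show ((i + 2 + j : ℕ) : ℝ) = ((i + 1 + (j + 1) : ℕ) : ℝ) by congr 1; omega,
      hr _ (by omega) (by omega)] at b
    omega
  · have a := mechWord_eq h0 i
    have b := mechWord_eq h0 (i + 1)
    have hα : ⌊α⌋ = 0 := Int.floor_eq_zero_iff.2 ⟨h0.le, h1⟩
    have c := hr 1 le_rfl (by omega)
    have d := hl 1 le_rfl (by omega)
    rw [show i + 1 - 1 = i by omega] at d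
    rw [Nat.cast_one, one_mul, hα] at c d
    omega

theorem abs_mul_sub_pos (hα : Irrational α) {j : ℕ} (hj : 1 ≤ j) (m : ℤ) :
    0 < |(j : ℝ) * α - m| := by
  rw [abs_pos, sub_ne_zero]
  exact (hα.natCast_mul (by omega)).ne_int m

theorem exists_forall_le_abs_mul_sub (hα : Irrational α) (N : ℕ) :
    ∃ ε > 0, ∀ j : ℕ, 1 ≤ j → j ≤ N → ∀ m : ℤ, ε ≤ |(j : ℝ) * α - m| := by
  induction N with
  | zero => exact ⟨1, one_pos, fun j h1 h2 => by omega⟩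
  | succ N ih =>
    obtain ⟨ε, hε, h⟩ := ih
    refine ⟨min ε |((N + 1 : ℕ) : ℝ) * α - round (((N + 1 : ℕ) : ℝ) * α)|,
      lt_min hε (abs_mul_sub_pos hα (by omega) _), fun j h1 h2 m => ?_⟩
    rcases Nat.lt_or_ge N j with hj | hj
    · obtain rfl : j = N + 1 := by omega
      exact (min_le_right _ _).trans (round_le _ _)
    · exact (min_le_left _ _).trans (h j h1 hj m)

theorem exists_first_abs_mul_sub_lt (α : ℝ) {ε : ℝ} (hε : 0 < ε) :
    ∃ n : ℕ, 1 ≤ n ∧ (∃ K : ℤ, |(n : ℝ) * α - K| < ε) ∧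
      ∀ j : ℕ, 1 ≤ j → j < n → ∀ m : ℤ, ε ≤ |(j : ℝ) * α - m| := by
  classical
  have h : ∃ n : ℕ, 1 ≤ n ∧ ∃ K : ℤ, |(n : ℝ) * α - K| < ε := by
    obtain ⟨N, hN⟩ := exists_nat_one_div_lt hε
    obtain ⟨k, hk, -, hk'⟩ := Real.exists_nat_abs_mul_sub_round_le α (Nat.succ_pos N)
    refine ⟨k, hk, _, lt_of_le_of_lt hk' (lt_of_le_of_lt ?_ hN)⟩
    push_cast
    gcongr
    linarith
  refine ⟨Nat.find h, (Nat.find_spec h).1, (Nat.find_spec h).2, fun j h1 h2 m => ?_⟩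
  have := Nat.find_min h h2
  push Not at this
  exact this h1 m

/-- Best approximations from above to multiples of `α` exist to every precision. -/
theorem exists_best_approx_from_above (hα : Irrational α) {ε : ℝ} (hε : 0 < ε) (hε1 : ε ≤ 1) :
    ∃ n : ℕ, 1 ≤ n ∧ ∃ K : ℤ, (n : ℝ) * α - K < 0 ∧ -ε < (n : ℝ) * α - K ∧
      ∀ j : ℕ, 1 ≤ j → j < n → ∀ m : ℤ, -((n : ℝ) * α - K) < |(j : ℝ) * α - m| := by
  obtain ⟨n, hn, ⟨K, hK⟩, hmin⟩ := exists_first_abs_mul_sub_lt α hε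
  have hK' := abs_lt.1 hK
  rcases lt_or_gt_of_ne (abs_pos.1 (abs_mul_sub_pos hα hn K)) with hneg | hpos
  · refine ⟨n, hn, K, hneg, hK'.1, fun j h1 h2 m => ?_⟩
    rw [← abs_of_neg hneg]
    exact hK.trans_le (hmin j h1 h2 m)
  -- The next record approximation lies on the other side or supplies a bound from above at once:
  -- were it positive too, n' - n would already beat the error of n.
  · obtain ⟨n', hn', ⟨K', hK2⟩, hmin'⟩ := exists_first_abs_mul_sub_lt α hpos
    have hK2' := abs_lt.1 hK2
    rcases lt_or_gt_of_ne (abs_pos.1 (abs_mul_sub_pos hα hn' K')) with hneg | hpos'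
    · refine ⟨n', hn', K', hneg, by linarith, fun j h1 h2 m => ?_⟩
      rw [← abs_of_neg hneg]
      exact hK2.trans_le (hmin' j h1 h2 m)
    · exfalso
      have hle : n ≤ n' := by
        by_contra! hlt
        have := hmin n' hn' hlt K'
        rw [abs_of_pos hpos'] at this
        linarith
      rcases hle.eq_or_lt with rfl | hlt
      · have a : (0 : ℝ) < ((K' - K : ℤ) : ℝ) := by push_cast; linarith
        have b : ((K' - K : ℤ) : ℝ) < 1 := by push_cast; linarith
        have a' : 0 < K' - K := by exact_mod_cast a
        have b' : K' - K < 1 := by exact_mod_cast b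
        omega
      · have := hmin' (n' - n) (by omega) (by omega) (K' - K)
        rw [Nat.cast_sub hle] at this
        push_cast at this
        rw [abs_of_neg (by linarith)] at this
        linarith

theorem floor_near (j : ℕ) {e : ℝ} (h : ∀ m : ℤ, |e| < |(j : ℝ) * α - m|) :
    ((⌊(j : ℝ) * α⌋ : ℝ) ≤ j * α + e ∧ j * α + e < ⌊(j : ℝ) * α⌋ + 1) ∧
      ((⌊(j : ℝ) * α⌋ : ℝ) < j * α - e ∧ j * α - e ≤ ⌊(j : ℝ) * α⌋ + 1) := by
  have h1 := h ⌊(j : ℝ) * α⌋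
  have h2 := h (⌊(j : ℝ) * α⌋ + 1)
  have h3 := Int.floor_le ((j : ℝ) * α)
  have h4 := Int.lt_floor_add_one ((j : ℝ) * α)
  push_cast at h2
  rw [abs_of_nonneg (sub_nonneg.2 h3)] at h1
  rw [abs_of_neg (sub_neg.2 h4)] at h2
  have h5 := le_abs_self e
  have h6 := neg_le_abs e
  refine ⟨⟨?_, ?_⟩, ?_, ?_⟩ <;> linarith

theorem exists_long_mirrorAt (hα : Irrational α) (h0 : 0 < α) (h1 : α < 1) (J : ℕ) :
    ∃ i ≥ J, MirrorAt (mechWord α) i J ∧ mechWord α i + mechWord α (i + 1) = 1 := by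
  obtain ⟨ε, hε, h⟩ := exists_forall_le_abs_mul_sub hα (J + 1)
  obtain ⟨n, hn, ⟨K, hK⟩, -⟩ := exists_first_abs_mul_sub_lt α hε
  have hJn : J + 1 < n := by
    by_contra! hle
    exact absurd hK (not_lt.2 (h n hn hle K))
  obtain ⟨i, rfl⟩ : ∃ i, n = i + 1 := ⟨n - 1, by omega⟩
  refine ⟨i, by omega, mirrorAt_of_near h0 h1 (e := ((i + 1 : ℕ) : ℝ) * α - K) (by omega)
    (add_sub_cancel (K : ℝ) _).symm fun j hj hj' => ?_⟩
  exact floor_near j fun m => hK.trans_le (h j hj hj' m)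

theorem exists_full_mirrorAt (hα : Irrational α) (h0 : 0 < α) (h1 : α < 1) (N : ℕ) :
    ∃ i ≥ N, MirrorAt (mechWord α) i i ∧ mechWord α i = 0 ∧ mechWord α (i + 1) = 1 ∧
      mechWord α (2 * i + 2) = 1 := by
  obtain ⟨ε, hε, h⟩ := exists_forall_le_abs_mul_sub hα (N + 1)
  -- With error e, the bound e > -(1 - α) makes letter i equal to 0, and e > -α/2 makes letter 2i +
  -- 2 equal to 1; ε forces n > N + 1.
  obtain ⟨n, hn, K, hneg, hK, hbest⟩ := exists_best_approx_from_above hα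
    (ε := min ε (min (α / 2) (1 - α))) (lt_min hε (lt_min (by linarith) (by linarith)))
    ((min_le_right _ _).trans ((min_le_left _ _).trans (by linarith)))
  have hε1 := min_le_left ε (min (α / 2) (1 - α))
  have hε2 := (min_le_right ε (min (α / 2) (1 - α))).trans (min_le_left _ _)
  have hε3 := (min_le_right ε (min (α / 2) (1 - α))).trans (min_le_right _ _)
  have hNn : N + 1 < n := by
    by_contra! hle
    have := h n hn hle K
    rw [abs_of_neg hneg] at this
    linarith
  obtain ⟨i, rfl⟩ : ∃ i, n = i + 1 := ⟨n - 1, by omega⟩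
  set e : ℝ := ((i + 1 : ℕ) : ℝ) * α - K with he
  have hfl : ⌊((i + 1 : ℕ) : ℝ) * α⌋ = K - 1 := by
    rw [Int.floor_eq_iff]
    push_cast at he ⊢
    constructor <;> linarith
  obtain ⟨hm, hsum⟩ := mirrorAt_of_near h0 h1 (i := i) (J := i) (K := K) (e := e) le_rfl
    (by rw [he]; ring) (by
      intro j hj hj'
      rcases hj'.lt_or_eq with hlt | rfl
      · exact floor_near j fun m => by
          rw [abs_of_neg hneg]
          exact hbest j hj hlt m
      -- The endpoint j = i + 1 is not covered by best approximation; here jα - e = K attains the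
      -- non-strict bound.
      · rw [hfl]
        push_cast at he ⊢
        refine ⟨⟨?_, ?_⟩, ?_, ?_⟩ <;> linarith)
  have a := mechWord_eq h0 i
  have hi : ⌊(i : ℝ) * α⌋ = K - 1 := by
    rw [Int.floor_eq_iff]
    push_cast at he ⊢
    constructor <;> linarith
  have hw : mechWord α i = 0 := by omega
  refine ⟨i, by omega, hm, hw, by omega, ?_⟩
  have b := mechWord_eq h0 (2 * i + 2)
  have c1 : ⌊((2 * i + 2 : ℕ) : ℝ) * α⌋ = 2 * K - 1 := by
    rw [Int.floor_eq_iff]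
    push_cast at he ⊢
    constructor <;> linarith
  have c2 : ⌊((2 * i + 2 + 1 : ℕ) : ℝ) * α⌋ = 2 * K := by
    rw [Int.floor_eq_iff]
    push_cast at he ⊢
    constructor <;> linarith
  omega

end MechWord

/-! ### Comparing backward and forward continued fractions of a coded word. -/

/-- `s ↦ [0; c, c + s]`. -/
noncomputable def pairMap (c s : ℝ) : ℝ := 1 / (c + 1 / (c + s))

/-- Two inversions preserve order, and each factor of the denominator is at least 2, whence the
contraction by 1/4. -/
theorem pairMap_sub {c s t : ℝ} (hc : 1 ≤ c) (hs : 0 ≤ s) (ht : 0 ≤ t) :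
    pairMap c s - pairMap c t = (s - t) / ((c ^ 2 + c * s + 1) * (c ^ 2 + c * t + 1)) := by
  have key : ∀ u : ℝ, 0 ≤ u → pairMap c u = (c + u) / (c ^ 2 + c * u + 1) := by
    intro u hu
    have : c + u ≠ 0 := by positivity
    rw [pairMap]
    field_simp
  have h1 : c ^ 2 + c * s + 1 ≠ 0 := by positivity
  have h2 : c ^ 2 + c * t + 1 ≠ 0 := by positivity
  rw [key s hs, key t ht]
  field_simp
  ring

theorem pairMap_lt_iff {c s t : ℝ} (hc : 1 ≤ c) (hs : 0 ≤ s) (ht : 0 ≤ t) :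
    pairMap c s < pairMap c t ↔ s < t := by
  rw [← sub_neg, pairMap_sub hc hs ht, div_neg_iff, ← sub_neg (a := s)]
  have : 0 < (c ^ 2 + c * s + 1) * (c ^ 2 + c * t + 1) := by positivity
  constructor
  · rintro (⟨_, h⟩ | ⟨h, _⟩)
    · linarith
    · exact h
  · exact fun h => Or.inr ⟨h, this⟩

theorem abs_pairMap_sub_le {c s t : ℝ} (hc : 1 ≤ c) (hs : 0 ≤ s) (ht : 0 ≤ t) :
    |pairMap c s - pairMap c t| ≤ 1 / 4 * |s - t| := by
  have h1 : 2 ≤ c ^ 2 + c * s + 1 := by nlinarith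
  have h2 : 2 ≤ c ^ 2 + c * t + 1 := by nlinarith
  have h3 : 4 ≤ (c ^ 2 + c * s + 1) * (c ^ 2 + c * t + 1) := by nlinarith
  rw [pairMap_sub hc hs ht, abs_div, abs_of_pos (by linarith :
    0 < (c ^ 2 + c * s + 1) * (c ^ 2 + c * t + 1)), div_le_iff₀ (by linarith)]
  nlinarith [abs_nonneg (s - t)]

theorem pairMap_one_bounds {s : ℝ} (h0 : 0 ≤ s) : 1 / 2 ≤ pairMap 1 s ∧ pairMap 1 s < 1 := by
  have h : pairMap 1 s = (1 + s) / (2 + s) := by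
    have : 1 + s ≠ 0 := by positivity
    rw [pairMap]
    field_simp
    ring
  rw [h, div_le_div_iff₀ (by norm_num) (by positivity), div_lt_one (by positivity)]
  constructor <;> linarith

theorem pairMap_two_bounds {s : ℝ} (h0 : 0 ≤ s) : 2 / 5 ≤ pairMap 2 s ∧ pairMap 2 s < 1 / 2 := by
  have h : pairMap 2 s = (2 + s) / (5 + 2 * s) := by
    have : 2 + s ≠ 0 := by positivity
    rw [pairMap]
    field_simp
    ring
  rw [h, div_le_div_iff₀ (by norm_num) (by positivity), div_lt_div_iff₀ (by positivity) (by norm_num)]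
  constructor <;> linarith

/-- `ℓ i` and `ξ i` are the continued fractions obtained by reading the word `w`, with its letters
`0` and `1` replaced by `1, 1` and `2, 2`, backwards and forwards from position `i`. -/
structure IsPairCoding (w : ℕ → ℕ) (ℓ ξ : ℕ → ℝ) : Prop where
  letter_le : ∀ i, w i ≤ 1
  ell_mem : ∀ i, ℓ i ∈ Set.Icc (0 : ℝ) 1
  xi_nonneg : ∀ i, 0 ≤ ξ i
  ell_succ : ∀ i, ℓ (i + 1) = pairMap (1 + w i) (ℓ i)
  xi_eq : ∀ i, ξ i = pairMap (1 + w i) (ξ (i + 1))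

namespace IsPairCoding

variable {w : ℕ → ℕ} {ℓ ξ : ℕ → ℝ}

theorem ell_succ_zero (h : IsPairCoding w ℓ ξ) {i : ℕ} (hi : w i = 0) :
    ℓ (i + 1) = pairMap 1 (ℓ i) := by
  rw [h.ell_succ, hi]; norm_num

theorem ell_succ_one (h : IsPairCoding w ℓ ξ) {i : ℕ} (hi : w i = 1) :
    ℓ (i + 1) = pairMap 2 (ℓ i) := by
  rw [h.ell_succ, hi]; norm_num

theorem xi_zero (h : IsPairCoding w ℓ ξ) {i : ℕ} (hi : w i = 0) :
    ξ i = pairMap 1 (ξ (i + 1)) := by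
  rw [h.xi_eq, hi]; norm_num

theorem xi_one (h : IsPairCoding w ℓ ξ) {i : ℕ} (hi : w i = 1) :
    ξ i = pairMap 2 (ξ (i + 1)) := by
  rw [h.xi_eq, hi]; norm_num

theorem xi_mem (h : IsPairCoding w ℓ ξ) (i : ℕ) : 2 / 5 ≤ ξ i ∧ ξ i < 1 := by
  have := h.letter_le i
  rcases (by omega : w i = 0 ∨ w i = 1) with hi | hi
  · rw [h.xi_zero hi]
    have := pairMap_one_bounds (h.xi_nonneg (i + 1))
    constructor <;> linarith
  · rw [h.xi_one hi]
    have := pairMap_two_bounds (h.xi_nonneg (i + 1))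
    constructor <;> linarith

/-- Matching letters apply the same increasing contraction to both sides, so order is transported
and distance shrinks by 4 per letter. -/
theorem mirror (h : IsPairCoding w ℓ ξ) {i J : ℕ} (hJ : J ≤ i) (hm : MirrorAt w i J) :
    (ℓ i < ξ (i + 2) ↔ ℓ (i - J) < ξ (i + 2 + J)) ∧
    (ξ (i + 2) < ℓ i ↔ ξ (i + 2 + J) < ℓ (i - J)) ∧
    |ℓ i - ξ (i + 2)| ≤ (1 / 4) ^ J * |ℓ (i - J) - ξ (i + 2 + J)| := by
  induction J with
  | zero => simp
  | succ J ih =>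
    obtain ⟨i1, i2, i3⟩ := ih (by omega) fun j hj => hm j (by omega)
    have e := hm J (by omega)
    have a := h.ell_succ (i - 1 - J)
    have b := h.xi_eq (i + 2 + J)
    rw [show i - 1 - J + 1 = i - J by omega, e, show i - 1 - J = i - (J + 1) by omega] at a
    rw [add_assoc (i + 2)] at b
    have hc : (1 : ℝ) ≤ 1 + w (i + 2 + J) := by simp
    have hl := (h.ell_mem (i - (J + 1))).1
    have hx := h.xi_nonneg (i + 2 + (J + 1))
    rw [a, b] at i1 i2 i3
    rw [pairMap_lt_iff hc hl hx] at i1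
    rw [pairMap_lt_iff hc hx hl] at i2
    refine ⟨i1, i2, i3.trans ?_⟩
    rw [pow_succ, mul_assoc]
    exact mul_le_mul_of_nonneg_left (abs_pairMap_sub_le hc hl hx) (by positivity)

theorem abs_sub_le (h : IsPairCoding w ℓ ξ) {i J : ℕ} (hJ : J ≤ i) (hm : MirrorAt w i J) :
    |ℓ i - ξ (i + 2)| ≤ (1 / 4) ^ J := by
  refine (h.mirror hJ hm).2.2.trans (mul_le_of_le_one_right (by positivity) ?_)
  have a := h.ell_mem (i - J)
  have b := h.xi_mem (i + 2 + J)
  rw [abs_le]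
  constructor <;> linarith [a.1, a.2, b.1, b.2]

/-- The value 1/2 separates the letters: a reading starting with 0 is at least 1/2, one starting
with 1 is below it. -/
theorem xi_lt_ell (h : IsPairCoding w ℓ ξ) {i J : ℕ} (hJ : J < i) (hm : MirrorAt w i J)
    (h1 : w (i - 1 - J) = 0) (h2 : w (i + 2 + J) = 1) : ξ (i + 2) < ℓ i := by
  rw [(h.mirror hJ.le hm).2.1, show i - J = i - 1 - J + 1 by omega, h.ell_succ_zero h1, h.xi_one h2]
  exact (pairMap_two_bounds (h.xi_nonneg _)).2.trans_le (pairMap_one_bounds (h.ell_mem _).1).1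

theorem ell_lt_xi (h : IsPairCoding w ℓ ξ) {i J : ℕ} (hJ : J < i) (hm : MirrorAt w i J)
    (h1 : w (i - 1 - J) = 1) (h2 : w (i + 2 + J) = 0) : ℓ i < ξ (i + 2) := by
  rw [(h.mirror hJ.le hm).1, show i - J = i - 1 - J + 1 by omega, h.ell_succ_one h1, h.xi_zero h2]
  exact (pairMap_two_bounds (h.ell_mem _).1).2.trans_le (pairMap_one_bounds (h.xi_nonneg _)).1

end IsPairCoding

/-! ### Approximation constants of the coded continued fractions. -/

/-- Partial quotients: `n + 1` copies of `d`, followed by the mechanical word of slope `α` with its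
letters `0` and `1` replaced by `1, 1` and `2, 2`. -/
noncomputable def codedQuot (d n : ℕ) (α : ℝ) (k : ℕ) : ℕ :=
  if k ≤ n then d else 1 + mechWord α ((k - n - 1) / 2)

theorem codedQuot_of_le {d n : ℕ} {α : ℝ} {k : ℕ} (h : k ≤ n) : codedQuot d n α k = d := by
  simp [codedQuot, h]

theorem codedQuot_fst (d n : ℕ) (α : ℝ) (i : ℕ) :
    codedQuot d n α (n + 2 * i + 1) = 1 + mechWord α i := by
  rw [codedQuot, if_neg (by omega)]
  congr 2
  omega

theorem codedQuot_snd (d n : ℕ) (α : ℝ) (i : ℕ) :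
    codedQuot d n α (n + 2 * i + 2) = 1 + mechWord α i := by
  rw [codedQuot, if_neg (by omega)]
  congr 2
  omega

theorem codedQuot_injOn (d n : ℕ) : Set.InjOn (codedQuot d n) (Set.Ioi 0) := by
  intro α hα β hβ h
  refine mechWord_injOn hα hβ (funext fun i => ?_)
  have := congrFun h (n + 2 * i + 1)
  rw [codedQuot_fst, codedQuot_fst] at this
  omega

theorem one_le_codedQuot {d : ℕ} (hd : 1 ≤ d) (n : ℕ) (α : ℝ) (k : ℕ) :
    1 ≤ codedQuot d n α k := by
  rw [codedQuot]
  split <;> omega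

theorem IsCompleteQuotients.backQuot_le_one {A : ℕ → ℕ} {R : ℕ → ℝ}
    (h : IsCompleteQuotients A R) (k : ℕ) : backQuot A k ≤ 1 := by
  cases k with
  | zero => simp [backQuot]
  | succ k =>
    have := h.one_le (k + 1)
    have := h.backQuot_nonneg k
    rw [backQuot, div_le_one (by linarith)]
    linarith

section Coded

variable {d n : ℕ} {α : ℝ} {R : ℕ → ℝ}

theorem isPairCoding_codedQuot (h0 : 0 < α) (h1 : α < 1)
    (h : IsCompleteQuotients (codedQuot d n α) R) :
    IsPairCoding (mechWord α) (fun i => backQuot (codedQuot d n α) (n + 2 * i))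
      (fun i => 1 / R (n + 2 * i + 1)) where
  letter_le := mechWord_le_one h0 h1
  ell_mem i := ⟨h.backQuot_nonneg _, h.backQuot_le_one _⟩
  xi_nonneg i := (one_div_pos.2 (h.pos _)).le
  ell_succ i := by
    change backQuot (codedQuot d n α) (n + 2 * i + 1 + 1) = _
    rw [backQuot, backQuot, codedQuot_snd, codedQuot_fst, pairMap]
    push_cast
    rfl
  xi_eq i := by
    rw [(h (n + 2 * i + 1)).2.2, (h (n + 2 * i + 1 + 1)).2.2, codedQuot_snd, codedQuot_fst, pairMap]
    push_cast
    rfl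

theorem approxConst_fst (h : IsCompleteQuotients (codedQuot d n α) R) (i : ℕ) :
    approxConst (codedQuot d n α) R (n + 2 * i) =
      1 + mechWord α i + 1 / (1 + mechWord α i + 1 / R (n + 2 * (i + 1) + 1)) +
        backQuot (codedQuot d n α) (n + 2 * i) := by
  rw [approxConst, (h (n + 2 * i + 1)).2.2, (h (n + 2 * i + 1 + 1)).2.2, codedQuot_snd,
    codedQuot_fst]
  push_cast
  rfl

theorem approxConst_snd (h : IsCompleteQuotients (codedQuot d n α) R) (i : ℕ) :
    approxConst (codedQuot d n α) R (n + 2 * i + 1) =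
      1 + mechWord α i + 1 / R (n + 2 * (i + 1) + 1) +
        1 / (1 + mechWord α i + backQuot (codedQuot d n α) (n + 2 * i)) := by
  rw [approxConst, (h (n + 2 * i + 1 + 1)).2.2, codedQuot_snd, backQuot, codedQuot_fst]
  push_cast
  rfl

/-- The source of the threshold 3: at a pair 2, 2 it replaces 2 + 1/(2 + s) by 3 - [0; 1, 1 + s]. -/
theorem one_div_two_add {s : ℝ} (hs : 0 ≤ s) : 1 / (2 + s) = 1 - pairMap 1 s := by
  have : 1 + s ≠ 0 := by positivity
  rw [pairMap]
  field_simp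
  ring

theorem approxConst_fst_lt_of_zero (h0 : 0 < α) (h1 : α < 1)
    (h : IsCompleteQuotients (codedQuot d n α) R) {i : ℕ} (hi : mechWord α i = 0) :
    approxConst (codedQuot d n α) R (n + 2 * i) < 3 := by
  have hp := isPairCoding_codedQuot h0 h1 h
  have hx := (hp.xi_mem (i + 1)).1
  have hl := (hp.ell_mem i).2
  rw [approxConst_fst h, hi]
  have : 1 / (1 + ((0 : ℕ) : ℝ) + 1 / R (n + 2 * (i + 1) + 1)) < 1 := by
    rw [Nat.cast_zero, div_lt_one (by linarith)]
    linarith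
  push_cast at this ⊢
  linarith

theorem approxConst_snd_lt_of_zero (h0 : 0 < α) (h1 : α < 1)
    (h : IsCompleteQuotients (codedQuot d n α) R) {i : ℕ} (hi : mechWord α i = 0) :
    approxConst (codedQuot d n α) R (n + 2 * i + 1) < 3 := by
  have hp := isPairCoding_codedQuot h0 h1 h
  have hx := (hp.xi_mem (i + 1)).2
  have hl := (hp.ell_mem i).1
  rw [approxConst_snd h, hi]
  have : 1 / (1 + ((0 : ℕ) : ℝ) + backQuot (codedQuot d n α) (n + 2 * i)) ≤ 1 := by
    rw [Nat.cast_zero, div_le_one (by linarith)]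
    linarith
  push_cast at this ⊢
  linarith

theorem approxConst_fst_of_one (h : IsCompleteQuotients (codedQuot d n α) R) {i : ℕ}
    (hi : mechWord α i = 1) :
    approxConst (codedQuot d n α) R (n + 2 * i) =
      3 + (backQuot (codedQuot d n α) (n + 2 * i) -
        pairMap 1 (1 / R (n + 2 * (i + 1) + 1))) := by
  rw [approxConst_fst h, hi, Nat.cast_one, one_add_one_eq_two,
    one_div_two_add (one_div_pos.2 (h.pos _)).le]
  ring

theorem approxConst_snd_of_one (h : IsCompleteQuotients (codedQuot d n α) R) {i : ℕ}
    (hi : mechWord α i = 1) :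
    approxConst (codedQuot d n α) R (n + 2 * i + 1) =
      3 + (1 / R (n + 2 * (i + 1) + 1) -
        pairMap 1 (backQuot (codedQuot d n α) (n + 2 * i))) := by
  rw [approxConst_snd h, hi, Nat.cast_one, one_add_one_eq_two,
    one_div_two_add (h.backQuot_nonneg _)]
  ring

theorem approxConst_of_ascent (h0 : 0 < α) (h1 : α < 1)
    (h : IsCompleteQuotients (codedQuot d n α) R) {i : ℕ}
    (hi : mechWord α i = 0) (hi' : mechWord α (i + 1) = 1) :
    approxConst (codedQuot d n α) R (n + 2 * (i + 1)) =
      3 + (pairMap 1 (backQuot (codedQuot d n α) (n + 2 * i)) -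
        pairMap 1 (1 / R (n + 2 * (i + 2) + 1))) := by
  rw [approxConst_fst_of_one h hi']
  have := (isPairCoding_codedQuot h0 h1 h).ell_succ_zero hi
  rw [this]

theorem approxConst_of_descent (h0 : 0 < α) (h1 : α < 1)
    (h : IsCompleteQuotients (codedQuot d n α) R) {i : ℕ}
    (hi : mechWord α i = 1) (hi' : mechWord α (i + 1) = 0) :
    approxConst (codedQuot d n α) R (n + 2 * i + 1) =
      3 + (pairMap 1 (1 / R (n + 2 * (i + 2) + 1)) -
        pairMap 1 (backQuot (codedQuot d n α) (n + 2 * i))) := by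
  rw [approxConst_snd_of_one h hi]
  have := (isPairCoding_codedQuot h0 h1 h).xi_zero hi'
  rw [this]

theorem approxConst_snd_lt (h0 : 0 < α) (h1 : α < 1)
    (h : IsCompleteQuotients (codedQuot d n α) R) (i : ℕ) :
    approxConst (codedQuot d n α) R (n + 2 * i + 1) < 3 := by
  have hp := isPairCoding_codedQuot h0 h1 h
  have l1 := mechWord_le_one h0 h1 i
  have l2 := mechWord_le_one h0 h1 (i + 1)
  rcases (by omega : mechWord α i = 0 ∨ mechWord α i = 1) with hi | hi
  · exact approxConst_snd_lt_of_zero h0 h1 h hi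
  rcases (by omega : mechWord α (i + 1) = 0 ∨ mechWord α (i + 1) = 1) with hi' | hi'
  · rw [approxConst_of_descent h0 h1 h hi hi']
    obtain ⟨J, hJ, hm, a, b⟩ := mechWord_mismatch_of_descent h0 h1 hi hi'
    have := (pairMap_lt_iff le_rfl (hp.xi_nonneg _) (hp.ell_mem _).1).2 (hp.xi_lt_ell hJ hm a b)
    linarith
  · rw [approxConst_snd_of_one h hi]
    have a := hp.xi_one hi'
    have b := (pairMap_two_bounds (hp.xi_nonneg (i + 1 + 1))).2
    have c := (pairMap_one_bounds (hp.ell_mem i).1).1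
    linarith

/-- After a 1, the backward value is below 1/2 and the constant is below 3. After a 0, only a tie
escapes the first mismatch. -/
theorem approxConst_fst_lt_or (h0 : 0 < α) (h1 : α < 1)
    (h : IsCompleteQuotients (codedQuot d n α) R) (i : ℕ) :
    approxConst (codedQuot d n α) R (n + 2 * i) < 3 ∨
      ∃ m, i = m + 1 ∧ mechWord α m = 0 ∧ mechWord α (m + 1) = 1 ∧
        MirrorAt (mechWord α) m m := by
  have hp := isPairCoding_codedQuot h0 h1 h
  have l1 := mechWord_le_one h0 h1 i
  rcases (by omega : mechWord α i = 0 ∨ mechWord α i = 1) with hi | hi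
  · exact Or.inl (approxConst_fst_lt_of_zero h0 h1 h hi)
  cases i with
  | zero =>
    rw [mechWord_zero h0 h1] at hi
    omega
  | succ m =>
    have l2 := mechWord_le_one h0 h1 m
    rcases (by omega : mechWord α m = 0 ∨ mechWord α m = 1) with hm | hm
    · rcases mechWord_mismatch_of_ascent h0 h1 hm hi with hmir | ⟨J, hJ, hmir, a, b⟩
      · exact Or.inr ⟨m, rfl, hm, hi, hmir⟩
      · left
        rw [approxConst_of_ascent h0 h1 h hm hi]
        have := (pairMap_lt_iff le_rfl (hp.ell_mem _).1 (hp.xi_nonneg _)).2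
          (hp.ell_lt_xi hJ hmir a b)
        linarith
    · left
      rw [approxConst_fst_of_one h hi]
      have a := hp.ell_succ_one hm
      have b := (pairMap_two_bounds (hp.ell_mem m).1).2
      have c := (pairMap_one_bounds (hp.xi_nonneg (m + 1 + 1))).1
      linarith

theorem approxConst_fst_le (h0 : 0 < α) (h1 : α < 1)
    (h : IsCompleteQuotients (codedQuot d n α) R) (i : ℕ) :
    approxConst (codedQuot d n α) R (n + 2 * i) ≤ 3 + (1 / 4) ^ i := by
  have hp := isPairCoding_codedQuot h0 h1 h
  rcases approxConst_fst_lt_or h0 h1 h i with hlt | ⟨m, rfl, hm, hm', hmir⟩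
  · have : (0 : ℝ) < (1 / 4) ^ i := by positivity
    linarith
  · rw [approxConst_of_ascent h0 h1 h hm hm', pow_succ']
    have a := abs_pairMap_sub_le le_rfl (hp.ell_mem m).1 (hp.xi_nonneg (m + 2))
    have b := hp.abs_sub_le le_rfl hmir
    have c := (le_abs_self _).trans a
    linarith

theorem le_approxConst_of_mirrorAt (h0 : 0 < α) (h1 : α < 1)
    (h : IsCompleteQuotients (codedQuot d n α) R) {i J : ℕ} (hJ : J ≤ i)
    (hm : MirrorAt (mechWord α) i J) (hsum : mechWord α i + mechWord α (i + 1) = 1) :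
    ∃ k ≥ i, 3 - (1 / 4) ^ J ≤ approxConst (codedQuot d n α) R k := by
  have hp := isPairCoding_codedQuot h0 h1 h
  have a := abs_pairMap_sub_le le_rfl (hp.ell_mem i).1 (hp.xi_nonneg (i + 2))
  have b := hp.abs_sub_le hJ hm
  have c := (le_abs_self _).trans a
  have c' := (neg_le_abs _).trans a
  have e : (0 : ℝ) < (1 / 4) ^ J := by positivity
  rcases (by omega : (mechWord α i = 0 ∧ mechWord α (i + 1) = 1) ∨
    (mechWord α i = 1 ∧ mechWord α (i + 1) = 0)) with ⟨hi, hi'⟩ | ⟨hi, hi'⟩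
  · refine ⟨n + 2 * (i + 1), by omega, ?_⟩
    rw [approxConst_of_ascent h0 h1 h hi hi']
    linarith
  · refine ⟨n + 2 * i + 1, by omega, ?_⟩
    rw [approxConst_of_descent h0 h1 h hi hi']
    linarith

theorem lagrangeValue_codedQuot (hα : Irrational α) (h0 : 0 < α) (h1 : α < 1)
    (h : IsCompleteQuotients (codedQuot d n α) R) : lagrangeValue (R 0) = 3 := by
  refine h.lagrangeValue_eq_three (fun c hc => ?_) fun c hc => ?_
  · rw [Set.infinite_iff_exists_gt]
    intro N
    obtain ⟨J, hJ⟩ := exists_pow_lt_of_lt_one (sub_pos.2 hc) (by norm_num : (1 / 4 : ℝ) < 1)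
    obtain ⟨i, hi, hm, hsum⟩ := exists_long_mirrorAt hα h0 h1 (max J (N + 1))
    obtain ⟨k, hk, hle⟩ := le_approxConst_of_mirrorAt h0 h1 h (J := J)
      ((le_max_left _ _).trans hi) (fun j hj => hm j (hj.trans_le (le_max_left _ _))) hsum
    have := le_max_right J (N + 1)
    refine ⟨k, ?_, by omega⟩
    rw [Set.mem_ofPred_eq]
    linarith
  · obtain ⟨J, hJ⟩ := exists_pow_lt_of_lt_one (sub_pos.2 hc) (by norm_num : (1 / 4 : ℝ) < 1)
    refine (Set.finite_lt_nat (n + 2 * J)).subset fun k hk => ?_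
    rw [Set.mem_ofPred_eq] at hk ⊢
    by_contra! hle
    obtain ⟨i, hi⟩ : ∃ i, k = n + 2 * i ∨ k = n + 2 * i + 1 := ⟨(k - n) / 2, by omega⟩
    rcases hi with rfl | rfl
    · have a := approxConst_fst_le h0 h1 h i
      have b : (1 / 4 : ℝ) ^ i ≤ (1 / 4) ^ J :=
        pow_le_pow_of_le_one (by norm_num) (by norm_num) (by omega)
      linarith
    · have := approxConst_snd_lt h0 h1 h i
      linarith

theorem infinite_ratSolutions_codedQuot (hα : Irrational α) (h0 : 0 < α) (h1 : α < 1)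
    (h : IsCompleteQuotients (codedQuot d n α) R)
    (hback : 1 / 2 ≤ backQuot (codedQuot d n α) n) : (ratSolutions 3 (R 0)).Infinite := by
  rw [h.ratSolutions_eq (by norm_num)]
  refine Set.Infinite.image h.convergent_injective.injOn ?_
  rw [Set.infinite_iff_exists_gt]
  intro N
  obtain ⟨i, hi, hm, a, b, c⟩ := exists_full_mirrorAt hα h0 h1 N
  have hp := isPairCoding_codedQuot h0 h1 h
  refine ⟨n + 2 * (i + 1), ?_, by omega⟩
  rw [Set.mem_ofPred_eq, approxConst_of_ascent h0 h1 h a b]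
  -- The forward reading past the symmetry starts with the letter 1, so it is below 1/2 and hence
  -- below the value of the initial block.
  have hlt := (hp.mirror le_rfl hm).2.1.2 (by
    rw [show i + 2 + i = 2 * i + 2 by omega, hp.xi_one c, Nat.sub_self]
    exact (pairMap_two_bounds (hp.xi_nonneg _)).2.trans_le hback)
  have := (pairMap_lt_iff le_rfl (hp.xi_nonneg _) (hp.ell_mem _).1).2 hlt
  linarith

theorem approxConst_lt_of_backQuot_lt (h0 : 0 < α) (h1 : α < 1)
    (h : IsCompleteQuotients (codedQuot d n α) R)
    (hback : backQuot (codedQuot d n α) n < 2 / 5) {k : ℕ} (hk : n ≤ k) :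
    approxConst (codedQuot d n α) R k < 3 := by
  obtain ⟨i, hi⟩ : ∃ i, k = n + 2 * i ∨ k = n + 2 * i + 1 := ⟨(k - n) / 2, by omega⟩
  rcases hi with rfl | rfl
  · have hp := isPairCoding_codedQuot h0 h1 h
    rcases approxConst_fst_lt_or h0 h1 h i with hlt | ⟨m, rfl, hm, hm', hmir⟩
    · exact hlt
    · rw [approxConst_of_ascent h0 h1 h hm hm']
      have hlt := (hp.mirror le_rfl hmir).1.2 (by
        rw [Nat.sub_self]
        exact hback.trans_le (hp.xi_mem _).1)
      have := (pairMap_lt_iff le_rfl (hp.ell_mem _).1 (hp.xi_nonneg _)).2 hlt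
      linarith
  · exact approxConst_snd_lt h0 h1 h i

theorem encard_ratSolutions_codedQuot (h0 : 0 < α) (h1 : α < 1)
    (h : IsCompleteQuotients (codedQuot 3 n α) R) : (ratSolutions 3 (R 0)).encard = n := by
  have hback : ∀ k ≤ n, backQuot (codedQuot 3 n α) k < 2 / 5 := by
    rintro (_ | k) hk
    · norm_num [backQuot]
    · have := h.backQuot_nonneg k
      rw [backQuot, codedQuot_of_le hk, div_lt_div_iff₀ (by positivity) (by norm_num)]
      push_cast
      linarith
  -- For k < n the complete quotient R (k + 1) already exceeds its integer part 3; from k = n on,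
  -- all ties break downwards since [0; 3, …] < 2/5.
  have hset : {k | 3 < approxConst (codedQuot 3 n α) R k} = Set.Iio n := by
    ext k
    rw [Set.mem_ofPred_eq, Set.mem_Iio]
    constructor
    · intro hk
      by_contra! hle
      exact hk.not_gt (approxConst_lt_of_backQuot_lt h0 h1 h (hback n le_rfl) hle)
    · intro hk
      have e := (h (k + 1)).2.2
      rw [codedQuot_of_le (by omega : k + 1 ≤ n)] at e
      have a := one_div_pos.2 (h.pos (k + 1 + 1))
      have b := h.backQuot_nonneg k
      rw [approxConst, e]
      push_cast
      linarith
  rw [h.ratSolutions_eq (by norm_num), h.convergent_injective.encard_image, hset,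
    ← Finset.coe_range, Set.encard_coe_eq_coe_finsetCard, Finset.card_range]

end Coded

/-! ### Uncountability. -/

theorem not_countable_irrational_Ioo : ¬ {α : ℝ | Irrational α ∧ 0 < α ∧ α < 1}.Countable := by
  intro hc
  have h2 : (Set.Ioo (0 : ℝ) 1).Countable := by
    refine (hc.union (Set.countable_range ((↑) : ℚ → ℝ))).mono fun x hx => ?_
    by_cases hr : x ∈ Set.range ((↑) : ℚ → ℝ)
    · exact Or.inr hr
    · exact Or.inl ⟨hr, hx.1, hx.2⟩
  have h3 := Cardinal.mk_Ioo_real (zero_lt_one' ℝ)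
  rw [← Cardinal.le_aleph0_iff_set_countable, h3] at h2
  exact absurd h2 (not_le.2 Cardinal.aleph0_lt_continuum)

theorem not_countable_of_codedQuot {d n : ℕ} (hd : 1 ≤ d) {S : Set ℝ}
    (hS : ∀ (α : ℝ) (R : ℕ → ℝ), Irrational α → 0 < α → α < 1 →
      IsCompleteQuotients (codedQuot d n α) R → R 0 ∈ S) : ¬ S.Countable := by
  intro hc
  choose R hR using fun α => exists_isCompleteQuotients _ (one_le_codedQuot hd n α)
  refine not_countable_irrational_Ioo (Set.MapsTo.countable_of_injOn (f := fun α => R α 0)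
    (fun α hα => hS α (R α) hα.1 hα.2.1 hα.2.2 (hR α)) (fun α hα β hβ h => ?_) hc)
  exact codedQuot_injOn d n hα.2.1 hβ.2.1 ((hR α).eq_of_zero_eq (hR β) h)

theorem not_countable_exactSolSet (n : ℕ∞) : ¬ (exactSolSet n).Countable := by
  cases n with
  | top =>
    refine not_countable_of_codedQuot (d := 1) (n := 2) le_rfl fun α R hα h0 h1 h =>
      ⟨h.irrational, lagrangeValue_codedQuot hα h0 h1 h, Set.encard_eq_top_iff.2
        (infinite_ratSolutions_codedQuot hα h0 h1 h ?_)⟩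
    -- `A 0` does not enter `backQuot`, so three 1s give [0; 1, 1] = 1/2, exactly the threshold
    -- needed.
    rw [backQuot, backQuot, backQuot, codedQuot_of_le le_rfl, codedQuot_of_le (by norm_num)]
    norm_num
  | coe n =>
    exact not_countable_of_codedQuot (d := 3) (n := n) (by norm_num) fun α R hα h0 h1 h =>
      ⟨h.irrational, lagrangeValue_codedQuot hα h0 h1 h, encard_ratSolutions_codedQuot h0 h1 h⟩

theorem theorem1 :
    (∀ n : ℕ∞, ¬ (exactSolSet n).Countable) ∧ ¬ (finSolSet 3).Countable := by
  refine ⟨not_countable_exactSolSet, fun hc => not_countable_exactSolSet 0 (hc.mono ?_)⟩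
  exact fun x hx => ⟨hx.1, Set.finite_of_encard_eq_coe (k := 0) hx.2.2⟩
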